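/- Let $\Sigma$ be a finite alphabet. For a finite set $D$, a $(\Sigma,D)$-tree $T=(t,\ell)$ is a non-empty prefix-closed set $t\subseteq D^*$ with a labelling $\ell\colon t\to\Sigma$; the successors of $n\in t$ are the nodes $n\cdot d\in t$ with $d\in D$. An EU-pair over a finite set $Q$ is a pair $\langle E;U\rangle$ of a finite multiset $E$ over $Q$ and a set $U\subseteq Q$; a multiset $\mu$ satisfies it if $E\sqsubseteq\mu$ and $\mathrm{supp}(\mu\setminus E)\subseteq U$. An EU-constraint is a positive boolean formula (built from $\top,\bot,\wedge,\vee$) over EU-pairs. A map $\nu$ from a finite set $S'$ to $2^Q$ satisfies $\langle E;U\rangle$ if there is $\nu'\colon S'\to Q$ with $\nu'(s)\in\nu(s)$ for all $s$ such that the multiset $\{\!\{\nu'(s)\mid s\in S'\}\!\}$ satisfies $\langle E;U\rangle$; this extends to EU-constraints in the natural way. An alternating parity EU-automaton over $\Sigma$ is a tuple $A=(Q,q_{\mathrm{init}},\delta,\omega)$ with $Q$ a finite set, $q_{\mathrm{init}}\in Q$, $\delta$ a map from $Q\times\Sigma$ to EU-constraints over $Q$, and $\omega\colon Q\to\mathbb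 N$. An execution tree of $A$ over $T$ is a $(t\times Q,D\times Q)$-tree whose root is labelled $(\varepsilon,q_{\mathrm{init}})$, in which every other node $(d_i,q_i)_{i<k}$ is labelled $((d_i)_{i<k},q_{k-1})$, and such that for every node $x$ with label $(m,q)$ the map sending each successor $m\cdot d$ of $m$ to $\{q'\mid x\cdot(d,q')\text{ is a node}\}$ satisfies $\delta(q,\ell(m))$. The tree $T$ is accepted if it has an execution tree in which, on every infinite branch, the least priority $\omega(q)$ occurring infinitely often is even (finite branches are always accepting). The language of $A$ is the set of accepted trees, over all finite sets $D$. Let $|Q|$ be the number of states, $|\delta|_B$ the maximal size (number of nodes of the syntax tree) of a formula $\delta(q,\sigma)$, $|\delta|_E$ and $|\delta|_U$ the maximal sizes of an existential part $E$ (counted with multiplicity) and of a universal part $U$ of an EU-pair occurring in $\delta$ (maxima over empty sets being $0$), and $|\omega|$ the number of priorities used. **Theorem (complementation).** For every alternating parity EU-automaton $A=(Q,q_{\mathrm{init}},\delta,\omega)$ over $\Sigma$ there is an alternating parity EU-automaton $A^c=(Q^c,q_{\mathrm{init}}^c,\delta^c,\omega^c)$ over $\Sigma$ that recognises the complement of the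 language of $A$ (for every finite set $D$, a $(\Sigma,D)$-tree is accepted by $A^c$ if and only if it is not accepted by $A$) and, with $e=\max(|\delta|_E,1)$, satisfies $$|Q^c|\le 1+|Q|\bigl(2+|\Sigma|\cdot|\delta|_B\cdot e\,(1+2^{e})\bigr),\qquad |\delta^c|_B\le 4\,(1+|Q|)\cdot|\delta|_B\cdot e^3\cdot 4^{e},$$ $$|\delta^c|_E\le|\delta|_E+1,\qquad |\delta^c|_U\le\max(|\delta|_U,1),\qquad |\omega^c|\le|\omega|+1 .$$ -/

import Mathlib

universe u v w

namespace EUTree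

/-- Positive boolean combinations over a set `V` of boolean variables. -/
inductive PBF (V : Type v) : Type v
  | top : PBF V
  | bot : PBF V
  | var : V → PBF V
  | and : PBF V → PBF V → PBF V
  | or : PBF V → PBF V → PBF V

namespace PBF

/-- Satisfaction of a positive boolean formula, given the truth values of the variables. -/
def Sat {V : Type v} (val : V → Prop) : PBF V → Prop
  | top => True
  | bot => False
  | var x => val x
  | and φ ψ => Sat val φ ∧ Sat val ψ
  | or φ ψ => Sat val φ ∨ Sat val ψ

/-- The size of a formula: the number of nodes of its syntax tree
(occurrences of variables, constants and connectives). -/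
def size {V : Type v} : PBF V → ℕ
  | top => 1
  | bot => 1
  | var _ => 1
  | and φ ψ => size φ + size ψ + 1
  | or φ ψ => size φ + size ψ + 1

/-- The largest value of `f` on the variables that occur in a formula (`0` if there are none). -/
def maxVar {V : Type v} (f : V → ℕ) : PBF V → ℕ
  | top => 0
  | bot => 0
  | var x => f x
  | and φ ψ => max (maxVar f φ) (maxVar f ψ)
  | or φ ψ => max (maxVar f φ) (maxVar f ψ)

end PBF

/-- An EU-pair `⟨E; U⟩` over a finite set `S`: a multiset `E` (the existential part) and a
set `U` (the universal part). -/
structure EUPair (S : Type v) : Type v where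
  E : Multiset S
  U : Finset S

open scoped Classical in
/-- A multiset `μ` satisfies `⟨E; U⟩` when `E` is a submultiset of `μ` and the support of
`μ ∖ E` is included in `U`. -/
def EUPair.SatBy {S : Type v} (p : EUPair S) (μ : Multiset S) : Prop :=
  p.E ≤ μ ∧ ∀ s ∈ μ - p.E, s ∈ p.U

/-- An EU-constraint: a positive boolean formula over EU-pairs. -/
abbrev EUConstraint (S : Type v) : Type v := PBF (EUPair S)

/-- A marking of `S'` by `S` satisfies `⟨E; U⟩` when it has a unitary submarking `ν'`
(a function that selects one element of `ν t` for every `t`) whose image, as a multiset,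
satisfies `⟨E; U⟩`. A set `ν t` may be empty; then no unitary submarking exists. -/
def EUPair.SatByMarking {S' : Type w} [Fintype S'] {S : Type v} (ν : S' → Set S)
    (p : EUPair S) : Prop :=
  ∃ ν' : S' → S, (∀ t, ν' t ∈ ν t) ∧ p.SatBy (Finset.univ.val.map ν')

/-- A marking satisfies an EU-constraint; different EU-pairs of the constraint may use
different unitary submarkings. -/
def EUConstraint.SatByMarking {S' : Type w} [Fintype S'] {S : Type v} (ν : S' → Set S)
    (φ : EUConstraint S) : Prop :=
  PBF.Sat (fun p : EUPair S => p.SatByMarking ν) φ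

/-- A (non-empty) tree over the directions `D`, labelled by `Alph`: a set of finite words over
`D` that is closed under prefix, and a labelling of its nodes. -/
structure LTree (Alph : Type u) (D : Type w) : Type (max u w) where
  nodes : Set (List D)
  root_mem : [] ∈ nodes
  prefix_closed : ∀ m n : List D, m <+: n → n ∈ nodes → m ∈ nodes
  label : nodes → Alph

namespace LTree

variable {Alph : Type u} {D : Type w}

/-- The root of a tree. -/
def root (T : LTree Alph D) : T.nodes := ⟨[], T.root_mem⟩

/-- The successors of a node `n`: the nodes of the form `n · d` with `d : D`. -/
def succ (T : LTree Alph D) (n : T.nodes) : Set T.nodes :=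
  {m | ∃ d : D, (m : List D) = (n : List D) ++ [d]}

theorem finite_succ [Finite D] (T : LTree Alph D) (n : T.nodes) : Finite (T.succ n) := by
  choose f hf using fun m : T.succ n => m.2
  refine Finite.of_injective f fun a b h => ?_
  apply Subtype.ext
  apply Subtype.ext
  rw [hf a, hf b, h]

noncomputable instance [Finite D] (T : LTree Alph D) (n : T.nodes) : Fintype (T.succ n) :=
  haveI := T.finite_succ n
  Fintype.ofFinite _

/-- The infinite branches of a tree. -/
def IsInfiniteBranch (T : LTree Alph D) (b : ℕ → T.nodes) : Prop :=
  b 0 = T.root ∧ ∀ i, b (i + 1) ∈ T.succ (b i)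

end LTree

/-- An alternating parity EU tree automaton over the alphabet `Alph`. -/
structure AAPTA (Alph : Type u) : Type (max u (v + 1)) where
  State : Type v
  [fintypeState : Fintype State]
  init : State
  trans : State → Alph → EUConstraint State
  prio : State → ℕ

attribute [instance] AAPTA.fintypeState

/-- A sequence of priorities is accepting when the least priority that appears infinitely
often is even. -/
def ParityAccepting (p : ℕ → ℕ) : Prop :=
  ∃ k, IsLeast {j | ∃ᶠ i in Filter.atTop, p i = j} k ∧ Even k

namespace AAPTA

variable {Alph : Type u} {D : Type w}

/-- The marking, induced at the node `n` of a tree `X` over `D × State`, of the successors of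
a node `m` of `T`: the successor `m · d` is marked with all the states `q` such that
`n · (d, q)` is a node of `X`. -/
def inducedMarking (A : AAPTA.{u, v} Alph) (T : LTree Alph D)
    (X : LTree (T.nodes × A.State) (D × A.State)) (n : X.nodes) (m : T.nodes) :
    T.succ m → Set A.State :=
  fun m' => {q | ∃ d : D, (m'.1 : List D) = (m : List D) ++ [d] ∧
    (n : List (D × A.State)) ++ [(d, q)] ∈ X.nodes}

/-- `X` is an execution tree of `A` over `T`. -/
structure IsExecutionTree [Finite D] (A : AAPTA.{u, v} Alph) (T : LTree Alph D)
    (X : LTree (T.nodes × A.State) (D × A.State)) : Prop where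
  label_root : X.label X.root = (T.root, A.init)
  label_snoc : ∀ (n : X.nodes) (l : List (D × A.State)) (d : D) (q : A.State),
    (n : List (D × A.State)) = l ++ [(d, q)] →
      ((X.label n).1 : List D) = l.map Prod.fst ++ [d] ∧ (X.label n).2 = q
  sat : ∀ n : X.nodes,
    (A.trans (X.label n).2 (T.label (X.label n).1)).SatByMarking
      (A.inducedMarking T X n (X.label n).1)

/-- `A` accepts `T` when some execution tree has only accepting branches. Finite branches are
always accepting; an infinite branch is accepting when its sequence of priorities is. -/
def Accepts [Finite D] (A : AAPTA.{u, v} Alph) (T : LTree Alph D) : Prop :=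
  ∃ X : LTree (T.nodes × A.State) (D × A.State), A.IsExecutionTree T X ∧
    ∀ b : ℕ → X.nodes, X.IsInfiniteBranch b →
      ParityAccepting fun i => A.prio (X.label (b i)).2

/-- The trees over the set of directions `D` that belong to the language of `A`. -/
def language (A : AAPTA.{u, v} Alph) (D : Type w) [Finite D] : Set (LTree Alph D) :=
  {T | A.Accepts T}

/-- The number of states. -/
def sizeQ (A : AAPTA.{u, v} Alph) : ℕ := Fintype.card A.State

/-- The maximal size of a formula in the transition function. -/
def sizeB [Fintype Alph] (A : AAPTA.{u, v} Alph) : ℕ :=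
  Finset.univ.sup fun x : A.State × Alph => (A.trans x.1 x.2).size

/-- The maximal size of an existential part in the transition function. -/
def sizeE [Fintype Alph] (A : AAPTA.{u, v} Alph) : ℕ :=
  Finset.univ.sup fun x : A.State × Alph => (A.trans x.1 x.2).maxVar fun p => p.E.card

/-- The maximal size of a universal part in the transition function. -/
def sizeU [Fintype Alph] (A : AAPTA.{u, v} Alph) : ℕ :=
  Finset.univ.sup fun x : A.State × Alph => (A.trans x.1 x.2).maxVar fun p => p.U.card

/-- The number of priorities. -/
def sizeP (A : AAPTA.{u, v} Alph) : ℕ := (Finset.univ.image A.prio).card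

/-- The size of `A` is at most `(sQ, sB, sE, sU, sP)`. -/
def SizeAtMost [Fintype Alph] (A : AAPTA.{u, v} Alph) (sQ sB sE sU sP : ℕ) : Prop :=
  A.sizeQ ≤ sQ ∧ A.sizeB ≤ sB ∧ A.sizeE ≤ sE ∧ A.sizeU ≤ sU ∧ A.sizeP ≤ sP

end AAPTA

end EUTree

namespace EUTree

theorem parityAccepting_shift_iff {p : ℕ → ℕ} (N : ℕ) :
    (ParityAccepting fun i => p (i + N)) ↔ ParityAccepting p := by
  have key : ∀ j, (∃ᶠ i in Filter.atTop, p (i + N) = j) ↔ ∃ᶠ i in Filter.atTop, p i = j := by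
    intro j
    conv_rhs => rw [← Filter.map_add_atTop_eq_nat N, Filter.frequently_map]
  simp only [ParityAccepting, key]

theorem parityAccepting_of_shift {p : ℕ → ℕ} (N : ℕ)
    (h : ParityAccepting fun i => p (i + N)) : ParityAccepting p :=
  (parityAccepting_shift_iff N).1 h

theorem not_parityAccepting_succ {p : ℕ → ℕ} (h : ParityAccepting p) :
    ¬ ParityAccepting fun i => p i + 1 := by
  rintro ⟨l, ⟨hl, hl'⟩, el⟩
  obtain ⟨k, ⟨hk, hk'⟩, ek⟩ := h
  have h1 : l ≤ k + 1 := hl' (hk.mono fun i hi => by simp only [hi])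
  obtain ⟨i, hi⟩ := Filter.Frequently.exists hl
  have h2 : k ≤ l - 1 := hk' (hl.mono fun i (hi : p i + 1 = l) => by omega)
  have hi : p i + 1 = l := hi
  have : l = k + 1 := by omega
  subst this
  exact (Nat.even_add_one.1 el) ek

/-! ### Parity games and positional determinacy -/

/-- A parity game in which, at a position `v`, the first player chooses a set in the upward
closed family `moves v` and the second player chooses the next position in that set. -/
structure Game (V : Type*) where
  moves : V → Set (Set V)
  upper : ∀ v, IsUpperSet (moves v)
  prio : V → ℕ

namespace Game

variable {V : Type*} (G : Game V)

/-- The game in which the players are exchanged. -/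
def dual : Game V where
  moves v := {W | Wᶜ ∉ G.moves v}
  upper v _ _ h hW hW' := hW (G.upper v (Set.compl_subset_compl.2 h) hW')
  prio v := G.prio v + 1

/-- The positions of priority `k` from which the first player can force a move to `X`. -/
def step (k : ℕ) (X : Set V) : Set V := {v | G.prio v = k ∧ X ∈ G.moves v}

theorem step_mono (k : ℕ) : Monotone (G.step k) :=
  fun _ _ h v hv => ⟨hv.1, G.upper v h hv.2⟩

open scoped Classical in
/-- The nested fixed point that describes the positions from which the first player can
either reach `Y` or win while seeing only priorities in `[k, k + m)`. -/
noncomputable def win : ℕ → ℕ → Set V → Set V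
  | 0, _, Y => Y
  | m + 1, k, Y =>
    -- An even least priority `k` may recur forever, hence a greatest fixed point; an odd one may
    -- not, hence a least one.
    if Even k then sSup {X | X ≤ win m (k + 1) (Y ∪ G.step k X)}
    else sInf {X | win m (k + 1) (Y ∪ G.step k X) ≤ X}

theorem win_mono (m k : ℕ) : Monotone (G.win m k) := by
  induction m generalizing k with
  | zero => exact fun _ _ h => h
  | succ m ih =>
    intro Y Y' h
    have hs : ∀ X, G.win m (k + 1) (Y ∪ G.step k X) ≤ G.win m (k + 1) (Y' ∪ G.step k X) :=
      fun X => ih _ (Set.union_subset_union_left _ h)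
    unfold win
    split_ifs
    · exact sSup_le_sSup fun X hX => le_trans hX (hs X)
    · exact sInf_le_sInf fun X hX => le_trans (hs X) hX

theorem win_succ_of_even {m k : ℕ} (hk : Even k) (Y : Set V) :
    G.win (m + 1) k Y = G.win m (k + 1) (Y ∪ G.step k (G.win (m + 1) k Y)) := by
  let f : Set V →o Set V := ⟨fun X => G.win m (k + 1) (Y ∪ G.step k X), fun _ _ h =>
    G.win_mono _ _ (Set.union_subset_union_right _ (G.step_mono k h))⟩
  have h : G.win (m + 1) k Y = OrderHom.gfp f := by
    simp only [win, hk, if_true]; rfl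
  rw [h]
  exact (OrderHom.map_gfp f).symm

theorem compl_sSup_postfixed {f g : Set V → Set V} (h : ∀ X, (f X)ᶜ = g Xᶜ) :
    (sSup {X | X ≤ f X})ᶜ = sInf {X | g X ≤ X} := by
  apply le_antisymm
  · refine le_sInf fun X hX => ?_
    rw [Set.compl_subset_comm]
    refine le_sSup (a := Xᶜ) ?_
    have := h Xᶜ
    rw [compl_compl] at this
    change Xᶜ ≤ f Xᶜ
    rw [Set.compl_subset_comm, this]
    exact hX
  · rw [Set.subset_compl_comm]
    refine sSup_le fun X hX => ?_
    rw [Set.subset_compl_comm]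
    refine sInf_le (a := Xᶜ) ?_
    change g Xᶜ ≤ Xᶜ
    rw [← h]
    exact Set.compl_subset_compl.2 hX

/-- Complementation turns greatest fixed points into least ones and the shift of priorities in
`dual` flips parities, so the two recursions match. Positions of priority below `k` are already
decided: they lie in `Y` or in the opponent's target. -/
theorem compl_win (m k : ℕ) (Y : Set V) (hY : ∀ v ∈ Y, G.prio v < k)
    (hG : ∀ v, G.prio v < k + m) :
    (G.win m k Y)ᶜ = G.dual.win m (k + 1) ({v | G.prio v < k} \ Y) := by
  induction m generalizing k Y with
  | zero =>
    ext v
    have := hG v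
    simp_all [win]
  | succ m ih =>
    have hf : ∀ X, (G.win m (k + 1) (Y ∪ G.step k X))ᶜ =
        G.dual.win m (k + 1 + 1) (({v | G.prio v < k} \ Y) ∪ G.dual.step (k + 1) Xᶜ) := by
      intro X
      rw [ih (k + 1) (Y ∪ G.step k X) ?_ fun v => by have := hG v; omega]
      · congr 1
        ext v
        simp only [step, dual, Set.mem_sdiff, Set.mem_ofPred_eq, Set.mem_union, compl_compl,
          Nat.lt_succ_iff_lt_or_eq, Nat.add_right_cancel_iff]
        constructor
        · tauto
        · rintro (h | h)
          · exact ⟨.inl h.1, fun h' => h'.elim h.2 fun h' => h.1.ne h'.1⟩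
          · exact ⟨.inr h.1, fun h' => h'.elim (fun h' => (hY v h').ne h.1) fun h' => h.2 h'.2⟩
      · rintro v (h | h)
        · exact (hY v h).trans (Nat.lt_succ_self k)
        · exact h.1.trans_lt (Nat.lt_succ_self k)
    by_cases hk : Even k
    · have hk' : ¬ Even (k + 1) := by simpa [Nat.even_add_one] using hk
      simp only [win, hk, hk', if_true, if_false]
      exact compl_sSup_postfixed hf
    · have hk' : Even (k + 1) := by simpa [Nat.even_add_one] using hk
      simp only [win, hk, hk', if_true, if_false]
      rw [compl_eq_comm]
      refine compl_sSup_postfixed fun X => ?_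
      rw [compl_eq_comm, hf, compl_compl]

/-- The positional strategy `σ` on the region `R` avoids priorities below `k` and wins every
play that stays outside of `Y`. -/
structure IsWinning (k : ℕ) (Y R : Set V) (σ : V → Set V) : Prop where
  mem : ∀ v ∈ R, v ∉ Y → σ v ∈ G.moves v
  subset : ∀ v ∈ R, v ∉ Y → σ v ⊆ R
  le : ∀ v ∈ R, v ∉ Y → k ≤ G.prio v
  parity : ∀ p : ℕ → V, (∀ i, p i ∈ R) → (∀ i, p i ∉ Y) → (∀ i, p (i + 1) ∈ σ (p i)) →
    ParityAccepting fun i => G.prio (p i)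

/-- Well-order the indices and play at each position the strategy of the least region containing it.
The index never increases along a play, so it is eventually constant, and the tail follows a single
winning strategy. -/
theorem exists_isWinning_iUnion {ι : Type*} {k : ℕ} {Y : Set V} {R : ι → Set V}
    {σ : ι → V → Set V} (h : ∀ i, G.IsWinning k Y (R i) (σ i)) :
    ∃ τ, G.IsWinning k Y (⋃ i, R i) τ := by
  classical
  have wf : WellFounded (WellOrderingRel : ι → ι → Prop) := IsWellFounded.wf
  let c : V → Set ι := fun v => {i | v ∈ R i}
  let r : V → ι → Prop := fun v i => v ∈ R i ∧ ∀ j, v ∈ R j → ¬ WellOrderingRel j i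
  have hr : ∀ v ∈ ⋃ i, R i, ∃ i, r v i := by
    intro v hv
    have hne : (c v).Nonempty := Set.mem_iUnion.1 hv
    exact ⟨wf.min _ hne, wf.min_mem _ hne, fun j hj => wf.not_lt_min _ hj⟩
  let τ : V → Set V := fun v => if hv : v ∈ ⋃ i, R i then σ (hr v hv).choose v else ∅
  have hτ : ∀ v ∈ ⋃ i, R i, ∃ i, r v i ∧ τ v = σ i v := by
    intro v hv
    exact ⟨_, (hr v hv).choose_spec, by simp only [τ, dif_pos hv]⟩
  refine ⟨τ, ?_, ?_, ?_, ?_⟩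
  · intro v hv hY
    obtain ⟨i, hi, e⟩ := hτ v hv
    rw [e]
    exact (h i).mem v hi.1 hY
  · intro v hv hY
    obtain ⟨i, hi, e⟩ := hτ v hv
    rw [e]
    exact ((h i).subset v hi.1 hY).trans (Set.subset_iUnion _ _)
  · intro v hv hY
    obtain ⟨i, hi, -⟩ := hτ v hv
    exact (h i).le v hi.1 hY
  · intro p hR hY hp
    choose a ha ea using fun i => hτ (p i) (hR i)
    have hne : (Set.range a).Nonempty := ⟨a 0, 0, rfl⟩
    obtain ⟨N, hN⟩ : wf.min _ hne ∈ Set.range a := wf.min_mem _ hne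
    have hmin : ∀ i, ¬ WellOrderingRel (a i) (a N) := fun i => by
      rw [hN]; exact wf.not_lt_min _ (Set.mem_range_self i)
    have hc : ∀ i, a (i + N) = a N := by
      intro i
      induction i with
      | zero => rw [Nat.zero_add]
      | succ i ih =>
        have h1 : p (i + 1 + N) ∈ R (a N) := by
          rw [← ih, Nat.add_right_comm]
          refine (h _).subset _ (ha (i + N)).1 (hY _) ?_
          rw [← ea]
          exact hp _
        rcases trichotomous_of WellOrderingRel (a (i + 1 + N)) (a N) with h2 | h2 | h2
        · exact absurd h2 (hmin _)
        · exact h2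
        · exact absurd h2 ((ha _).2 _ h1)
    refine parityAccepting_of_shift N ((h (a N)).parity (fun i => p (i + N)) ?_ (fun i => hY _) ?_)
    · intro i
      rw [← hc i]
      exact (ha _).1
    · intro i
      have := hp (i + N)
      rw [ea, hc, Nat.add_right_comm] at this
      exact this

theorem exists_isWinning (m k : ℕ) (Y : Set V) :
    ∃ R σ, G.win m k Y ⊆ R ∧ G.IsWinning k Y R σ := by
  classical
  induction m generalizing k Y with
  | zero =>
    exact ⟨Y, fun _ => ∅, subset_rfl, fun v h h' => absurd h h', fun v h h' => absurd h h',
      fun v h h' => absurd h h', fun p h h' => absurd (h 0) (h' 0)⟩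
  | succ m ih =>
    by_cases hk : Even k
    · obtain ⟨R, σ, hR, h⟩ := ih (k + 1) (Y ∪ G.step k (G.win (m + 1) k Y))
      rw [← G.win_succ_of_even hk] at hR
      set X := G.win (m + 1) k Y
      have hnot : ∀ v, v ∉ Y → v ∉ G.step k X → v ∉ Y ∪ G.step k X := fun v h h' => by simp [h, h']
      have hle : ∀ v ∈ R, v ∉ Y → k ≤ G.prio v := by
        intro v hv hY
        by_cases hs : v ∈ G.step k X
        · exact hs.1.ge
        · exact (Nat.le_succ k).trans (h.le v hv (hnot v hY hs))
      -- A play that meets `step k X` infinitely often has even least priority `k`; any other play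
      -- eventually follows `σ`.
      refine ⟨R, fun v => if v ∈ G.step k X then X else σ v, hR, ?_, ?_, hle, ?_⟩
      · intro v hv hY
        by_cases hs : v ∈ G.step k X
        · simp only [hs, if_true]
          exact hs.2
        · simp only [hs, if_false]
          exact h.mem v hv (hnot v hY hs)
      · intro v hv hY
        by_cases hs : v ∈ G.step k X
        · simp only [hs, if_true]
          exact hR
        · simp only [hs, if_false]
          exact h.subset v hv (hnot v hY hs)
      · intro p hpR hpY hp
        by_cases hf : ∃ᶠ i in Filter.atTop, p i ∈ G.step k X
        · refine ⟨k, ⟨hf.mono fun i hi => hi.1, fun j hj => ?_⟩, hk⟩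
          obtain ⟨i, hi⟩ := Filter.Frequently.exists hj
          exact hi ▸ hle _ (hpR i) (hpY i)
        · rw [Filter.not_frequently, Filter.eventually_atTop] at hf
          obtain ⟨N, hN⟩ := hf
          refine parityAccepting_of_shift N (h.parity (fun i => p (i + N)) (fun i => hpR _)
            (fun i => hnot _ (hpY _) (hN _ (Nat.le_add_left _ _))) fun i => ?_)
          have := hp (i + N)
          rw [if_neg (hN _ (Nat.le_add_left _ _)), Nat.add_right_comm] at this
          exact this
    -- For odd `k`, the union `P` of all winning regions is shown to be a pre-fixed point, hence to
    -- contain the least fixed point.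
    · let ι := {x : Set V × (V → Set V) // G.IsWinning k Y x.1 x.2}
      obtain ⟨τ, hτ⟩ := G.exists_isWinning_iUnion (ι := ι) (R := fun i => i.1.1)
        (σ := fun i => i.1.2) fun i => i.2
      set P : Set V := ⋃ i : ι, i.1.1
      refine ⟨P, τ, ?_, hτ⟩
      simp only [win, hk, if_false]
      refine sInf_le ?_
      obtain ⟨R, σ, hR, h⟩ := ih (k + 1) (Y ∪ G.step k P)
      refine hR.trans ?_
      have hnot : ∀ v, v ∉ Y → v ∉ G.step k P → v ∉ Y ∪ G.step k P := fun v h h' => by simp [h, h']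
      let ρ : V → Set V := fun v => if v ∈ P then τ v else if v ∈ G.step k P then P else σ v
      -- A play that meets `step k P` enters `P` at the next step and stays there. So `P ∪ R` is
      -- itself a winning region, and maximality of `P` gives `R ⊆ P`.
      have hρ : G.IsWinning k Y (P ∪ R) ρ := by
        have hRP : ∀ v ∈ P ∪ R, v ∉ P → v ∈ R := fun v hv hP => hv.resolve_left hP
        refine ⟨?_, ?_, ?_, ?_⟩
        · intro v hv hY
          by_cases hP : v ∈ P
          · simp only [ρ, hP, if_true]
            exact hτ.mem v hP hY
          · by_cases hs : v ∈ G.step k P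
            · simp only [ρ, hP, hs, if_true, if_false]
              exact hs.2
            · simp only [ρ, hP, hs, if_false]
              exact h.mem v (hRP v hv hP) (hnot v hY hs)
        · intro v hv hY
          by_cases hP : v ∈ P
          · simp only [ρ, hP, if_true]
            exact (hτ.subset v hP hY).trans Set.subset_union_left
          · by_cases hs : v ∈ G.step k P
            · simp only [ρ, hP, hs, if_true, if_false]
              exact Set.subset_union_left
            · simp only [ρ, hP, hs, if_false]
              exact (h.subset v (hRP v hv hP) (hnot v hY hs)).trans Set.subset_union_right
        · intro v hv hY
          by_cases hP : v ∈ P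
          · exact hτ.le v hP hY
          · by_cases hs : v ∈ G.step k P
            · exact hs.1.ge
            · exact (Nat.le_succ k).trans (h.le v (hRP v hv hP) (hnot v hY hs))
        · intro p hpR hpY hp
          by_cases hex : ∃ N, p N ∈ P
          · obtain ⟨N, hN⟩ := hex
            have hstep : ∀ i, p i ∈ P → p (i + 1) ∈ τ (p i) := by
              intro i hi
              have := hp i
              simp only [ρ, hi, if_true] at this
              exact this
            have hall : ∀ i, p (i + N) ∈ P := by
              intro i
              induction i with
              | zero => rwa [Nat.zero_add]
              | succ i ih =>
                rw [Nat.add_right_comm]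
                exact hτ.subset _ ih (hpY _) (hstep _ ih)
            refine parityAccepting_of_shift N (hτ.parity (fun i => p (i + N)) hall
              (fun i => hpY _) fun i => ?_)
            have := hstep _ (hall i)
            rwa [Nat.add_right_comm] at this
          · push Not at hex
            have hs : ∀ i, p i ∉ G.step k P := by
              intro i hi
              have := hp i
              simp only [ρ, hex i, hi, if_true, if_false] at this
              exact hex _ this
            refine h.parity p (fun i => hRP _ (hpR i) (hex i)) (fun i => hnot _ (hpY i) (hs i))
              fun i => ?_
            have := hp i
            simpa only [ρ, hex i, hs i, if_false] using this
      exact Set.subset_union_right.trans (Set.subset_iUnion (fun i : ι => i.1.1) ⟨(P ∪ R, ρ), hρ⟩)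

/-- Positional determinacy of parity games with finitely many priorities. -/
theorem determined {n : ℕ} (hn : ∀ v, G.prio v < n) (v : V) :
    (∃ R σ, v ∈ R ∧ G.IsWinning 0 ∅ R σ) ∨ ∃ R σ, v ∈ R ∧ G.dual.IsWinning 1 ∅ R σ := by
  by_cases hv : v ∈ G.win n 0 ∅
  · obtain ⟨R, σ, hR, h⟩ := G.exists_isWinning n 0 ∅
    exact .inl ⟨R, σ, hR hv, h⟩
  · have hc := G.compl_win n 0 ∅ (by simp) (by simpa using hn)
    rw [← Set.mem_compl_iff, hc] at hv
    obtain ⟨R, σ, hR, h⟩ := G.dual.exists_isWinning n 1 ∅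
    exact .inr ⟨R, σ, hR (by simpa using hv), h⟩

end Game

/-! ### From positional strategies to execution trees -/

theorem PBF.Sat.mono {V : Type v} {val val' : V → Prop} (h : ∀ x, val x → val' x) :
    ∀ {φ : PBF V}, φ.Sat val → φ.Sat val'
  | .top, _ => trivial
  | .bot, hφ => hφ
  | .var x, hφ => h x hφ
  | .and _ _, hφ => ⟨Sat.mono h hφ.1, Sat.mono h hφ.2⟩
  | .or _ _, hφ => hφ.imp (Sat.mono h) (Sat.mono h)

theorem EUConstraint.SatByMarking.mono {S' : Type w} [Fintype S'] {S : Type v}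
    {ν ν' : S' → Set S} (h : ∀ t, ν t ⊆ ν' t) {φ : EUConstraint S} (hφ : φ.SatByMarking ν) :
    φ.SatByMarking ν' :=
  PBF.Sat.mono (fun _ ⟨ρ, h1, h2⟩ => ⟨ρ, fun t => h t (h1 t), h2⟩) hφ

namespace AAPTA

variable {Alph : Type u} {D : Type w}

/-- The acceptance game of `A` on the tree `T`. -/
def game [Finite D] (A : AAPTA.{u, v} Alph) (T : LTree Alph D) : Game (T.nodes × A.State) where
  moves v := {W | (A.trans v.2 (T.label v.1)).SatByMarking
    fun t : T.succ v.1 => {q | (t.1, q) ∈ W}}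
  upper v W _ h hW := EUConstraint.SatByMarking.mono
    (ν := fun t : T.succ v.1 => {q | (t.1, q) ∈ W}) (fun _ _ hq => h hq) hW
  prio v := A.prio v.2

variable (A : AAPTA.{u, v} Alph) (T : LTree Alph D)

/-- The words over `D × A.State` that are compatible with the positional strategy `σ`, together
with the positions that they reach. -/
inductive Reach (σ : T.nodes × A.State → Set (T.nodes × A.State)) :
    List (D × A.State) → T.nodes × A.State → Prop
  | nil : Reach σ [] (T.root, A.init)
  | snoc {l v} (w : T.nodes × A.State) (d : D) (h : Reach σ l v) (hw : w ∈ σ v)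
      (hd : (w.1 : List D) = (v.1 : List D) ++ [d]) : Reach σ (l ++ [(d, w.2)]) w

variable {A T} {σ : T.nodes × A.State → Set (T.nodes × A.State)}

theorem Reach.fst {l v} (h : Reach A T σ l v) : (v.1 : List D) = l.map Prod.fst := by
  induction h with
  | nil => rfl
  | snoc w d h hw hd ih => rw [hd, ih]; simp

theorem Reach.of_snoc {l d q v} (h : Reach A T σ (l ++ [(d, q)]) v) :
    v.2 = q ∧ ∃ u, Reach A T σ l u ∧ v ∈ σ u := by
  generalize hl : l ++ [(d, q)] = l' at h
  cases h with
  | nil => simp at hl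
  | snoc w d' h hw hd =>
    obtain ⟨rfl, h2⟩ := List.append_inj' hl rfl
    simp only [List.cons.injEq, Prod.mk.injEq, and_true] at h2
    exact ⟨h2.2.symm, _, h, hw⟩

theorem Reach.unique {l v v'} (h : Reach A T σ l v) (h' : Reach A T σ l v') : v = v' := by
  refine Prod.ext (Subtype.ext (h.fst.trans h'.fst.symm)) ?_
  cases h with
  | nil =>
    generalize hl : ([] : List (D × A.State)) = l' at h'
    cases h' with
    | nil => rfl
    | snoc w d h hw hd => simp at hl
  | snoc w d h hw hd => exact h'.of_snoc.1.symm

/-- The plays consistent with `σ`, written as words over directions and states, form the execution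
tree. A word determines its position (`Reach.unique`), so labels may be chosen arbitrarily. -/
theorem accepts_of_strategy [Finite D] {R : Set (T.nodes × A.State)} (h0 : (T.root, A.init) ∈ R)
    (hmem : ∀ v ∈ R, σ v ∈ (A.game T).moves v) (hsub : ∀ v ∈ R, σ v ⊆ R)
    (hpar : ∀ p : ℕ → T.nodes × A.State, (∀ i, p i ∈ R) → (∀ i, p (i + 1) ∈ σ (p i)) →
      ParityAccepting fun i => A.prio (p i).2) : A.Accepts T := by
  have hpre : ∀ n m : List (D × A.State), m <+: n → (∃ v, Reach A T σ n v) →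
      ∃ v, Reach A T σ m v := by
    intro n
    induction n using List.reverseRecOn with
    | nil =>
      intro m hm h
      rwa [List.prefix_nil.1 hm]
    | append_singleton l x ih =>
      rintro m hm ⟨v, hv⟩
      rcases List.prefix_concat_iff.1 hm with rfl | hm
      · exact ⟨v, hv⟩
      · obtain ⟨-, u, hu, -⟩ := hv.of_snoc
        exact ih m hm ⟨u, hu⟩
  let X : LTree (T.nodes × A.State) (D × A.State) :=
    { nodes := {l | ∃ v, Reach A T σ l v}
      root_mem := ⟨_, Reach.nil⟩
      prefix_closed := fun m n => hpre n m
      label := fun n => n.2.choose }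
  have hX : ∀ n : X.nodes, Reach A T σ n.1 (X.label n) := fun n => n.2.choose_spec
  have hR : ∀ {l v}, Reach A T σ l v → v ∈ R := by
    intro l v h
    induction h with
    | nil => exact h0
    | snoc w d h hw hd ih => exact hsub _ ih hw
  refine ⟨X, ⟨(hX _).unique Reach.nil, ?_, ?_⟩, ?_⟩
  · intro n l d q hn
    have h := hX n
    rw [hn] at h
    exact ⟨by rw [h.fst]; simp, h.of_snoc.1⟩
  · intro n
    refine EUConstraint.SatByMarking.mono ?_ (hmem _ (hR (hX n)))
    intro t q hq
    obtain ⟨d, hd⟩ := t.2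
    exact ⟨d, hd, _, Reach.snoc (t.1, q) d (hX n) hq hd⟩
  · intro b hb
    refine hpar (fun i => X.label (b i)) (fun i => hR (hX _)) fun i => ?_
    obtain ⟨⟨d, q⟩, hd⟩ := hb.2 i
    have h := hX (b (i + 1))
    rw [hd] at h
    obtain ⟨-, u, hu, hu'⟩ := h.of_snoc
    rwa [(hX (b i)).unique hu]

theorem IsExecutionTree.label_fst [Finite D]
    {X : LTree (T.nodes × A.State) (D × A.State)} (hX : A.IsExecutionTree T X) (n : X.nodes) :
    ((X.label n).1 : List D) = (n : List (D × A.State)).map Prod.fst := by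
  rcases List.eq_nil_or_concat' n.1 with h | ⟨l, ⟨d, q⟩, h⟩
  · have : n = X.root := Subtype.ext h
    subst this
    rw [hX.label_root]
    rfl
  · rw [(hX.label_snoc n l d q h).1, h]
    simp

end AAPTA

/-! ### Gluing two matchings -/

section Matching

variable {ι S' : Type*}

/-- If one matching covers `ι` and another one covers `G`, then some matching covers both. -/
theorem exists_matching_covering (r : ι → S' → Prop) {G : Set S'} {f : ι → S'} {g : G → ι}
    (hf : Function.Injective f) (hg : Function.Injective g) (hfr : ∀ i, r i (f i))
    (hgr : ∀ t, r (g t) t) :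
    ∃ h : ι → S', Function.Injective h ∧ (∀ i, r i (h i)) ∧ ∀ t ∈ G, t ∈ Set.range h := by
  classical
  -- As in the Schröder–Bernstein argument: at a fixed point `A` of `Φ`, the map `f` on `A` and the
  -- inverse of `g` off `A` have disjoint images and together cover `G`.
  let Φ : Set ι →o Set ι := ⟨fun A => {i | ∀ t : G, g t = i → (t : S') ∈ f '' A},
    fun A B h i hi t ht => Set.image_mono h (hi t ht)⟩
  let A := OrderHom.lfp Φ
  have hA : ∀ i, i ∈ A ↔ ∀ t : G, g t = i → (t : S') ∈ f '' A := fun i => by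
    conv_lhs => rw [show A = Φ A from (OrderHom.map_lfp Φ).symm]
    rfl
  have hA' : ∀ i, i ∉ A → ∃ t : G, g t = i ∧ (t : S') ∉ f '' A := fun i hi => by
    rw [hA] at hi
    push Not at hi
    exact hi
  choose k hk hkA using hA'
  let h : ι → S' := fun i => if hi : i ∈ A then f i else k i hi
  have h1 : ∀ i ∈ A, h i = f i := fun i hi => dif_pos hi
  have h2 : ∀ i, ∀ hi : i ∉ A, h i = k i hi := fun i hi => dif_neg hi
  refine ⟨h, ?_, ?_, ?_⟩
  · intro i j hij
    by_cases hi : i ∈ A <;> by_cases hj : j ∈ A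
    · rw [h1 i hi, h1 j hj] at hij
      exact hf hij
    · rw [h1 i hi, h2 j hj] at hij
      exact absurd ⟨i, hi, hij⟩ (hkA j hj)
    · rw [h2 i hi, h1 j hj] at hij
      exact absurd ⟨j, hj, hij.symm⟩ (hkA i hi)
    · rw [h2 i hi, h2 j hj] at hij
      rw [← hk i hi, ← hk j hj, Subtype.ext hij]
  · intro i
    by_cases hi : i ∈ A
    · rw [h1 i hi]
      exact hfr i
    · rw [h2 i hi]
      have := hgr (k i hi)
      rwa [hk i hi] at this
  · intro t ht
    by_cases htA : t ∈ f '' A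
    · obtain ⟨i, hi, e⟩ := htA
      exact ⟨i, by rw [h1 i hi, e]⟩
    · have hi : g ⟨t, ht⟩ ∉ A := fun hi => htA ((hA _).1 hi ⟨t, ht⟩ rfl)
      refine ⟨g ⟨t, ht⟩, ?_⟩
      rw [h2 _ hi, hg (hk _ hi)]

end Matching

/-! ### EU-pairs as matching problems, and their negation -/

section Pair

variable {S' : Type w} [Fintype S'] {S : Type v}

theorem map_univ_eq_add {ι : Type*} [Fintype ι] [DecidableEq S'] {e : ι → S} {f : ι → S'}
    {ν : S' → S} (hf : Function.Injective f) (h : ∀ i, ν (f i) = e i) :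
    Finset.univ.val.map ν =
      Finset.univ.val.map e + (Finset.univ \ Finset.univ.image f).val.map ν := by
  have h1 : (Finset.univ.image f).val.map ν = Finset.univ.val.map e := by
    rw [Finset.image_val_of_injOn hf.injOn, Multiset.map_map]
    exact Multiset.map_congr rfl fun i _ => h i
  rw [← h1, ← Multiset.map_add, ← Finset.disjUnion_val _ _ Finset.disjoint_sdiff]
  congr 2
  ext t
  simp

/-- Multiplicities compare the cardinalities of fibres, so the injection is built fibre by fibre. -/
theorem exists_injective_of_map_le {ι : Type*} [Fintype ι] {e : ι → S} {ν : S' → S}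
    (h : Finset.univ.val.map e ≤ Finset.univ.val.map ν) :
    ∃ f : ι → S', Function.Injective f ∧ ∀ i, ν (f i) = e i := by
  classical
  have hc : ∀ a, Nonempty ({i // e i = a} ↪ {t // ν t = a}) := by
    intro a
    refine Function.Embedding.nonempty_of_card_le ?_
    have := Multiset.le_iff_count.1 h a
    rw [Multiset.count_map, Multiset.count_map] at this
    rw [Fintype.card_subtype, Fintype.card_subtype]
    simpa only [Finset.card, Finset.filter_val, eq_comm] using this
  let F : ∀ a, {i // e i = a} ↪ {t // ν t = a} := fun a => (hc a).some
  have hν : ∀ i, ν (F (e i) ⟨i, rfl⟩).1 = e i := fun i => (F (e i) ⟨i, rfl⟩).2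
  have hcast : ∀ a i (hi : e i = a), (F (e i) ⟨i, rfl⟩).1 = (F a ⟨i, hi⟩).1 := by
    rintro a i rfl; rfl
  refine ⟨fun i => (F (e i) ⟨i, rfl⟩).1, fun i j hij => ?_, hν⟩
  have he : e i = e j := by
    rw [← hν i, ← hν j]
    exact congrArg ν hij
  change (F (e i) ⟨i, rfl⟩).1 = (F (e j) ⟨j, rfl⟩).1 at hij
  rw [hcast (e j) i he] at hij
  exact congrArg Subtype.val ((F (e j)).injective (Subtype.ext hij))

theorem satByMarking_iff {ι : Type*} [Fintype ι] (e : ι → S) {p : EUPair S}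
    (he : p.E = Finset.univ.val.map e) (μ : S' → Set S) :
    p.SatByMarking μ ↔ ∃ f : ι → S', Function.Injective f ∧ (∀ i, e i ∈ μ (f i)) ∧
      ∀ t ∉ Set.range f, ∃ u ∈ p.U, u ∈ μ t := by
  classical
  constructor
  · rintro ⟨ν, hν, hE, hU⟩
    rw [he] at hE hU
    obtain ⟨f, hf, hfe⟩ := exists_injective_of_map_le hE
    refine ⟨f, hf, fun i => hfe i ▸ hν _, fun t ht => ⟨ν t, hU _ ?_, hν t⟩⟩
    rw [map_univ_eq_add hf hfe, Multiset.mem_sub, Multiset.count_add]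
    have : 0 < ((Finset.univ \ Finset.univ.image f).val.map ν).count (ν t) := by
      rw [Multiset.count_pos]
      refine Multiset.mem_map_of_mem _ ?_
      exact Finset.mem_sdiff.2 ⟨Finset.mem_univ _, by simpa using ht⟩
    omega
  · rintro ⟨f, hf, hfe, hU⟩
    choose u hu huμ using hU
    let ν : S' → S := fun t => if h : t ∈ Set.range f then e h.choose else u t h
    have h1 : ∀ i, ν (f i) = e i := fun i => by
      have h : f i ∈ Set.range f := ⟨i, rfl⟩
      simp only [ν, dif_pos h]
      rw [hf h.choose_spec]
    have h2 : ∀ t, ∀ ht : t ∉ Set.range f, ν t = u t ht := fun t ht => dif_neg ht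
    refine ⟨ν, fun t => ?_, ?_, ?_⟩
    · by_cases ht : t ∈ Set.range f
      · obtain ⟨i, rfl⟩ := ht
        rw [h1]
        exact hfe i
      · rw [h2 t ht]
        exact huμ t ht
    · rw [he, map_univ_eq_add hf h1]
      exact Multiset.le_add_right _ _
    · intro s hs
      rw [he, map_univ_eq_add hf h1] at hs
      have hs' : s ∈ (Finset.univ \ Finset.univ.image f).val.map ν := by
        rw [Multiset.mem_sub, Multiset.count_add] at hs
        rw [← Multiset.count_pos]
        omega
      obtain ⟨t, ht, rfl⟩ := Multiset.mem_map.1 hs'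
      have ht' : t ∉ Set.range f := by simpa using (Finset.mem_sdiff.1 ht).2
      rw [h2 t ht']
      exact hu t ht'

theorem satByMarking_replicate_iff (s s' : S) (n : ℕ) (μ : S' → Set S) :
    (⟨Multiset.replicate n s, {s'}⟩ : EUPair S).SatByMarking μ ↔
      ∃ J : Finset S', J.card = n ∧ (∀ t ∈ J, s ∈ μ t) ∧ ∀ t ∉ J, s' ∈ μ t := by
  classical
  rw [satByMarking_iff (fun _ : Fin n => s) (by simp)]
  constructor
  · rintro ⟨f, hf, hs, hs'⟩
    refine ⟨Finset.univ.image f, by rw [Finset.card_image_of_injective _ hf]; simp, ?_, ?_⟩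
    · intro t ht
      obtain ⟨i, -, rfl⟩ := Finset.mem_image.1 ht
      exact hs i
    · intro t ht
      obtain ⟨u, hu, hu'⟩ := hs' t (by simpa using ht)
      rwa [Finset.mem_singleton.1 hu] at hu'
  · rintro ⟨J, hJ, hs, hs'⟩
    let a : Fin n ≃ J := (Fintype.equivFinOfCardEq (by simpa using hJ)).symm
    refine ⟨fun i => (a i).1, fun i j h => a.injective (Subtype.ext h), fun i => hs _ (a i).2, ?_⟩
    intro t ht
    refine ⟨s', Finset.mem_singleton_self _, hs' t fun h => ht ⟨a.symm ⟨t, h⟩, by simp⟩⟩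

/-- The negation of an EU-pair on the complement of a marking. -/
theorem not_satByMarking_compl_iff {ι : Type*} [Fintype ι] (e : ι → S) {p : EUPair S}
    (he : p.E = Finset.univ.val.map e) (N : S' → Set S) :
    (¬ p.SatByMarking fun t => (N t)ᶜ) ↔
      (∃ (F : Finset ι) (J : Finset S'), J.card < F.card ∧ ∀ t ∉ J, ∀ i ∈ F, e i ∈ N t) ∨
      ∃ (F : Finset ι) (J : Finset S'), J.card = Fintype.card ι - F.card + 1 ∧
        ∀ t ∈ J, (∀ u ∈ p.U, u ∈ N t) ∧ ∀ i ∈ F, e i ∈ N t := by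
  classical
  rw [satByMarking_iff e he]
  constructor
  · intro h
    by_contra hc
    rw [not_or] at hc
    obtain ⟨h1, h2⟩ := hc
    refine h ?_
    -- Hall on the side of E: a violating `F` fits only on its neighbours, which form the first
    -- witness `J`.
    obtain ⟨f, hf, hfr⟩ := (Finset.all_card_le_biUnion_card_iff_exists_injective
      fun i => Finset.univ.filter fun t => e i ∉ N t).1 fun F => by
        by_contra hF
        refine h1 ⟨F, _, not_le.1 hF, fun t ht i hi => ?_⟩
        by_contra hn
        exact ht (Finset.mem_biUnion.2 ⟨i, hi, Finset.mem_filter.2 ⟨Finset.mem_univ _, hn⟩⟩)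
    let G : Set S' := {t | ∀ u ∈ p.U, u ∈ N t}
    obtain ⟨g, hg, hgr⟩ := (Finset.all_card_le_biUnion_card_iff_exists_injective
      fun t : G => Finset.univ.filter fun i => e i ∉ N t).1 fun K => by
        by_contra hK
        set B := K.biUnion fun t : G => Finset.univ.filter fun i => e i ∉ N t
        rw [← Finset.card_map (Function.Embedding.subtype _), not_le] at hK
        obtain ⟨J, hJ, hJc⟩ := Finset.exists_subset_card_eq (Nat.succ_le_of_lt hK)
        -- A violating `K` has neighbours `B` with |B| < |K|. Its elements refuse `Bᶜ`, and |B| + 1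
        -- of them suffice as witness.
        refine h2 ⟨Bᶜ, J, ?_, fun t ht => ?_⟩
        · rw [hJc, Finset.card_compl, Nat.sub_sub_self (Finset.card_le_univ B)]
        · obtain ⟨t, htK, rfl⟩ := Finset.mem_map.1 (hJ ht)
          refine ⟨t.2, fun i hi => ?_⟩
          by_contra hn
          refine Finset.mem_compl.1 hi (Finset.mem_biUnion.2 ⟨t, htK, ?_⟩)
          exact Finset.mem_filter.2 ⟨Finset.mem_univ _, hn⟩
    obtain ⟨k, hk, hkr, hkG⟩ := exists_matching_covering (fun i t => e i ∉ N t) hf hg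
      (fun i => (Finset.mem_filter.1 (hfr i)).2) fun t => (Finset.mem_filter.1 (hgr t)).2
    refine ⟨k, hk, hkr, fun t ht => ?_⟩
    have : t ∉ G := fun h => ht (hkG t h)
    simp only [G, Set.mem_ofPred_eq, not_forall] at this
    obtain ⟨u, hu, hu'⟩ := this
    exact ⟨u, hu, hu'⟩
  · rintro h ⟨f, hf, hfr, hU⟩
    rcases h with ⟨F, J, hc, hJ⟩ | ⟨F, J, hc, hJ⟩
    · refine hc.not_ge ?_
      rw [← Finset.card_image_of_injective F hf]
      refine Finset.card_le_card fun t ht => ?_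
      obtain ⟨i, hi, rfl⟩ := Finset.mem_image.1 ht
      by_contra hn
      exact hfr i (hJ _ hn i hi)
    -- All of `J` would have to be covered by occurrences outside `F`, of which there are too few.
    · refine (Nat.lt_of_succ_le hc.ge).not_ge ?_
      rw [← Finset.card_compl, ← Finset.card_image_of_injective Fᶜ hf]
      refine Finset.card_le_card fun t ht => ?_
      obtain ⟨htU, htF⟩ := hJ t ht
      have : t ∈ Set.range f := by
        by_contra hn
        obtain ⟨u, hu, hu'⟩ := hU t hn
        exact hu' (htU u hu)
      obtain ⟨i, rfl⟩ := this
      exact Finset.mem_image_of_mem f (Finset.mem_compl.2 fun hi => hfr i (htF i hi))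

end Pair

/-! ### Dualising positive boolean formulas -/

namespace PBF

variable {V : Type v} {W : Type w}

/-- The variables of a formula, one for each occurrence. -/
def vars : PBF V → List V
  | top => []
  | bot => []
  | var x => [x]
  | and φ ψ => vars φ ++ vars ψ
  | or φ ψ => vars φ ++ vars ψ

theorem length_vars_le (φ : PBF V) : φ.vars.length ≤ φ.size := by
  induction φ <;> simp only [vars, size, List.length_append, List.length_nil, List.length_cons] <;>
    omega

theorem le_maxVar (f : V → ℕ) {x : V} {φ : PBF V} (h : x ∈ φ.vars) : f x ≤ φ.maxVar f := by
  induction φ with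
  | top | bot => simp [vars] at h
  | var y => simp_all [vars, maxVar]
  | and φ ψ h1 h2 | or φ ψ h1 h2 =>
    rcases List.mem_append.1 h with h | h
    · exact (h1 h).trans (le_max_left _ _)
    · exact (h2 h).trans (le_max_right _ _)

/-- The disjunction of a list of formulas. -/
def bigOr (l : List (PBF V)) : PBF V := l.foldr or bot

/-- The conjunction of a list of formulas. -/
def bigAnd (l : List (PBF V)) : PBF V := l.foldr and top

theorem sat_bigOr {val : V → Prop} {l : List (PBF V)} :
    (bigOr l).Sat val ↔ ∃ φ ∈ l, φ.Sat val := by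
  induction l with
  | nil => simp [bigOr, Sat]
  | cons φ l ih => simpa [bigOr, Sat] using or_congr_right ih

theorem sat_bigAnd {val : V → Prop} {l : List (PBF V)} :
    (bigAnd l).Sat val ↔ ∀ φ ∈ l, φ.Sat val := by
  induction l with
  | nil => simp [bigAnd, Sat]
  | cons φ l ih => simpa [bigAnd, Sat] using and_congr_right fun _ => ih

theorem size_bigOr_le {l : List (PBF V)} {b : ℕ} (h : ∀ φ ∈ l, φ.size ≤ b) :
    (bigOr l).size ≤ l.length * (b + 1) + 1 := by
  induction l with
  | nil => simp [bigOr, size]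
  | cons φ l ih =>
    have h1 := h φ (by simp)
    have h2 := ih fun ψ hψ => h ψ (by simp [hψ])
    have h3 : (bigOr (φ :: l)).size = φ.size + (bigOr l).size + 1 := rfl
    rw [h3, List.length_cons, Nat.add_mul]
    omega

theorem size_bigAnd_le {l : List (PBF V)} {b : ℕ} (h : ∀ φ ∈ l, φ.size ≤ b) :
    (bigAnd l).size ≤ l.length * (b + 1) + 1 := by
  induction l with
  | nil => simp [bigAnd, size]
  | cons φ l ih =>
    have h1 := h φ (by simp)
    have h2 := ih fun ψ hψ => h ψ (by simp [hψ])
    have h3 : (bigAnd (φ :: l)).size = φ.size + (bigAnd l).size + 1 := rfl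
    rw [h3, List.length_cons, Nat.add_mul]
    omega

theorem maxVar_bigOr_le {f : V → ℕ} {l : List (PBF V)} {b : ℕ} (h : ∀ φ ∈ l, φ.maxVar f ≤ b) :
    (bigOr l).maxVar f ≤ b := by
  induction l with
  | nil => exact Nat.zero_le _
  | cons φ l ih => exact max_le (h φ (by simp)) (ih fun ψ hψ => h ψ (by simp [hψ]))

theorem maxVar_bigAnd_le {f : V → ℕ} {l : List (PBF V)} {b : ℕ} (h : ∀ φ ∈ l, φ.maxVar f ≤ b) :
    (bigAnd l).maxVar f ≤ b := by
  induction l with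
  | nil => exact Nat.zero_le _
  | cons φ l ih => exact max_le (h φ (by simp)) (ih fun ψ hψ => h ψ (by simp [hψ]))

/-- The dual of a formula, in which each variable `x` is replaced by the formula `g x`. -/
def dual (g : V → PBF W) : PBF V → PBF W
  | top => bot
  | bot => top
  | var x => g x
  | and φ ψ => or (dual g φ) (dual g ψ)
  | or φ ψ => and (dual g φ) (dual g ψ)

theorem not_sat_of_sat_dual {g : V → PBF W} {val : V → Prop} {val' : W → Prop} {φ : PBF V}
    (h : ∀ x ∈ φ.vars, (g x).Sat val' → ¬ val x) (hφ : (φ.dual g).Sat val') : ¬ φ.Sat val := by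
  induction φ with
  | top => exact hφ.elim
  | bot => exact id
  | var x => exact h x (by simp [vars]) hφ
  | and φ ψ h1 h2 =>
    intro hn
    rcases hφ with hφ | hφ
    · exact h1 (fun x hx => h x (by simp [vars, hx])) hφ hn.1
    · exact h2 (fun x hx => h x (by simp [vars, hx])) hφ hn.2
  | or φ ψ h1 h2 =>
    rintro (hn | hn)
    · exact h1 (fun x hx => h x (by simp [vars, hx])) hφ.1 hn
    · exact h2 (fun x hx => h x (by simp [vars, hx])) hφ.2 hn

theorem sat_dual_of_not_sat {g : V → PBF W} {val : V → Prop} {val' : W → Prop} {φ : PBF V}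
    (h : ∀ x ∈ φ.vars, ¬ val x → (g x).Sat val') (hφ : ¬ φ.Sat val) : (φ.dual g).Sat val' := by
  induction φ with
  | top => exact hφ trivial
  | bot => trivial
  | var x => exact h x (by simp [vars]) hφ
  | and φ ψ h1 h2 =>
    by_cases hn : φ.Sat val
    · exact .inr (h2 (fun x hx => h x (by simp [vars, hx])) fun hn' => hφ ⟨hn, hn'⟩)
    · exact .inl (h1 (fun x hx => h x (by simp [vars, hx])) hn)
  | or φ ψ h1 h2 =>
    exact ⟨h1 (fun x hx => h x (by simp [vars, hx])) fun hn => hφ (.inl hn),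
      h2 (fun x hx => h x (by simp [vars, hx])) fun hn => hφ (.inr hn)⟩

theorem size_dual_le {g : V → PBF W} {φ : PBF V} {b : ℕ} (hb : 1 ≤ b)
    (h : ∀ x ∈ φ.vars, (g x).size ≤ b) : (φ.dual g).size ≤ φ.size * b := by
  induction φ with
  | top | bot => simpa [dual, size] using hb
  | var x => simpa [dual, size] using h x (by simp [vars])
  | and φ ψ h1 h2 | or φ ψ h1 h2 =>
    have h1 := h1 fun x hx => h x (by simp [vars, hx])
    have h2 := h2 fun x hx => h x (by simp [vars, hx])
    simp only [dual, size, Nat.add_mul]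
    omega

theorem maxVar_dual_le {g : V → PBF W} {f : W → ℕ} {φ : PBF V} {b : ℕ}
    (h : ∀ x ∈ φ.vars, (g x).maxVar f ≤ b) : (φ.dual g).maxVar f ≤ b := by
  induction φ with
  | top | bot => exact Nat.zero_le _
  | var x => exact h x (by simp [vars])
  | and φ ψ h1 h2 | or φ ψ h1 h2 =>
    exact max_le (h1 fun x hx => h x (by simp [vars, hx])) (h2 fun x hx => h x (by simp [vars, hx]))

end PBF

/-! ### The complement automaton and its transitions -/

theorem exists_enum {S : Type v} (E : Multiset S) :
    ∃ e : Fin E.card → S, E = Finset.univ.val.map e := by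
  induction E using Quotient.inductionOn with
  | h l => exact ⟨l.get, (congrArg _ (List.ofFn_get l)).symm.trans (Fin.univ_val_map l.get).symm⟩

/-- An enumeration of the existential part of an EU-pair. -/
noncomputable def EUPair.enum {S : Type v} (p : EUPair S) : Fin p.E.card → S :=
  (exists_enum p.E).choose

theorem EUPair.enum_spec {S : Type v} (p : EUPair S) : p.E = Finset.univ.val.map p.enum :=
  (exists_enum p.E).choose_spec

namespace AAPTA

variable {Alph : Type u} [Fintype Alph] (A : AAPTA.{u, v} Alph)

open scoped Classical in
/-- The pairs, with first component `q`, that are needed in the negation of the EU-pair `p`. -/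
noncomputable def pairStates (q : A.State) (p : EUPair A.State) :
    Finset (A.State × Finset A.State) :=
  -- `(q, ∅)` is added once for all pairs in `complStates`; leaving it out here saves the one
  -- element that the bound needs when e = 1.
  ((Finset.univ.erase ∅).image fun F : Finset (Fin p.E.card) => (q, F.image p.enum)) ∪
    Finset.univ.image fun F : Finset (Fin p.E.card) => (q, p.U ∪ F.image p.enum)

open scoped Classical in
/-- The states of the complement automaton: a pair `(q, S)` stands for the conjunction of the
states in `S`, reached from the state `q`. -/
noncomputable def complStates : Finset (A.State × Finset A.State) :=
  insert (A.init, {A.init}) (Finset.univ.biUnion fun q => insert (q, ∅)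
    (Finset.univ.biUnion fun a => (A.trans q a).vars.toFinset.biUnion (A.pairStates q)))

/-- The type of the states of the complement automaton. -/
abbrev ComplState : Type v := {x // x ∈ A.complStates}

open scoped Classical in
/-- The pair `(q, S)` as a state of the complement automaton, with the initial state as default
value. -/
noncomputable def toComplState (q : A.State) (S : Finset A.State) : A.ComplState :=
  -- The default is never taken for the states needed to negate pairs that occur in transitions.
  if h : (q, S) ∈ A.complStates then ⟨_, h⟩
  else ⟨(A.init, {A.init}), Finset.mem_insert_self _ _⟩

open scoped Classical in
/-- The EU-pairs whose disjunction is the negation of the EU-pair `p`. -/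
noncomputable def dualPairs (q : A.State) (p : EUPair A.State) : Finset (EUPair A.ComplState) :=
  -- The two Hall witnesses. The state `(q, ∅)` is the empty conjunction, whose transition is `top`:
  -- it imposes nothing on a successor.
  (((Finset.univ ×ˢ Finset.range p.E.card).filter
    fun x : Finset (Fin p.E.card) × ℕ => x.2 < x.1.card).image fun x =>
      ⟨Multiset.replicate x.2 (A.toComplState q ∅), {A.toComplState q (x.1.image p.enum)}⟩) ∪
  Finset.univ.image fun F : Finset (Fin p.E.card) => ⟨Multiset.replicate (p.E.card - F.card + 1)
    (A.toComplState q (p.U ∪ F.image p.enum)), {A.toComplState q ∅}⟩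

/-- The negation of the EU-pair `p`. -/
noncomputable def dualFormula (q : A.State) (p : EUPair A.State) : EUConstraint A.ComplState :=
  PBF.bigOr ((A.dualPairs q p).toList.map PBF.var)

/-- The complement automaton. -/
noncomputable def compl : AAPTA.{u, v} Alph where
  State := A.ComplState
  init := A.toComplState A.init {A.init}
  trans s a := PBF.bigAnd (s.1.2.toList.map fun q => (A.trans q a).dual (A.dualFormula q))
  prio s := A.prio s.1.1 + 1

variable {A}

theorem val_toComplState {q : A.State} {S : Finset A.State} (h : (q, S) ∈ A.complStates) :
    (A.toComplState q S).1 = (q, S) := by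
  simp [toComplState, h]

theorem val_toComplState_init :
    (A.toComplState A.init {A.init}).1 = (A.init, {A.init}) := by
  classical
  exact val_toComplState (Finset.mem_insert_self _ _)

theorem val_toComplState_empty (q : A.State) : (A.toComplState q ∅).1 = (q, ∅) := by
  classical
  refine val_toComplState (Finset.mem_insert_of_mem (Finset.mem_biUnion.2 ⟨q, Finset.mem_univ _, ?_⟩))
  exact Finset.mem_insert_self _ _

theorem mem_complStates {q : A.State} {a : Alph} {p : EUPair A.State}
    (hp : p ∈ (A.trans q a).vars) {x : A.State × Finset A.State} (hx : x ∈ A.pairStates q p) :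
    x ∈ A.complStates := by
  classical
  refine Finset.mem_insert_of_mem (Finset.mem_biUnion.2 ⟨q, Finset.mem_univ _, ?_⟩)
  refine Finset.mem_insert_of_mem (Finset.mem_biUnion.2 ⟨a, Finset.mem_univ _, ?_⟩)
  exact Finset.mem_biUnion.2 ⟨p, List.mem_toFinset.2 hp, hx⟩

open scoped Classical in
theorem val_toComplState_image {q : A.State} {a : Alph} {p : EUPair A.State}
    (hp : p ∈ (A.trans q a).vars) {F : Finset (Fin p.E.card)} (hF : F.Nonempty) :
    (A.toComplState q (F.image p.enum)).1 = (q, F.image p.enum) :=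
  val_toComplState (mem_complStates hp (Finset.mem_union_left _ (Finset.mem_image.2
    ⟨F, Finset.mem_erase.2 ⟨hF.ne_empty, Finset.mem_univ _⟩, rfl⟩)))

open scoped Classical in
theorem val_toComplState_union {q : A.State} {a : Alph} {p : EUPair A.State}
    (hp : p ∈ (A.trans q a).vars) (F : Finset (Fin p.E.card)) :
    (A.toComplState q (p.U ∪ F.image p.enum)).1 = (q, p.U ∪ F.image p.enum) :=
  val_toComplState (mem_complStates hp (Finset.mem_union_right _ (Finset.mem_image.2
    ⟨F, Finset.mem_univ _, rfl⟩)))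

section Local

variable {S' : Type w} [Fintype S']

open scoped Classical in
theorem satByMarking_dualFormula_iff {q : A.State} {p : EUPair A.State}
    {M : S' → Set A.ComplState} :
    (A.dualFormula q p).SatByMarking M ↔
      (∃ (F : Finset (Fin p.E.card)) (J : Finset S'), J.card < F.card ∧
        (∀ t ∈ J, A.toComplState q ∅ ∈ M t) ∧
        ∀ t ∉ J, A.toComplState q (F.image p.enum) ∈ M t) ∨
      ∃ (F : Finset (Fin p.E.card)) (J : Finset S'), J.card = p.E.card - F.card + 1 ∧
        (∀ t ∈ J, A.toComplState q (p.U ∪ F.image p.enum) ∈ M t) ∧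
        ∀ t ∉ J, A.toComplState q ∅ ∈ M t := by
  have h1 : (A.dualFormula q p).SatByMarking M ↔ ∃ x ∈ A.dualPairs q p, x.SatByMarking M := by
    unfold dualFormula EUConstraint.SatByMarking
    rw [PBF.sat_bigOr]
    simp [PBF.Sat]
  rw [h1]
  constructor
  · rintro ⟨x, hx, hM⟩
    rcases Finset.mem_union.1 hx with hx | hx
    · obtain ⟨⟨F, j⟩, hF, rfl⟩ := Finset.mem_image.1 hx
      obtain ⟨J, rfl, hJ⟩ := (satByMarking_replicate_iff _ _ _ _).1 hM
      exact .inl ⟨F, J, (Finset.mem_filter.1 hF).2, hJ⟩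
    · obtain ⟨F, -, rfl⟩ := Finset.mem_image.1 hx
      obtain ⟨J, hJ⟩ := (satByMarking_replicate_iff _ _ _ _).1 hM
      exact .inr ⟨F, J, hJ⟩
  · rintro (⟨F, J, h, hJ⟩ | ⟨F, J, hJ⟩)
    · have hF : F.card ≤ p.E.card := by simpa using Finset.card_le_univ F
      refine ⟨_, Finset.mem_union_left _ (Finset.mem_image.2 ⟨(F, J.card), ?_, rfl⟩),
        (satByMarking_replicate_iff _ _ _ _).2 ⟨J, rfl, hJ⟩⟩
      exact Finset.mem_filter.2 ⟨Finset.mem_product.2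
        ⟨Finset.mem_univ _, Finset.mem_range.2 (h.trans_le hF)⟩, h⟩
    · exact ⟨_, Finset.mem_union_right _ (Finset.mem_image.2 ⟨F, Finset.mem_univ _, rfl⟩),
        (satByMarking_replicate_iff _ _ _ _).2 ⟨J, hJ⟩⟩

/-- Soundness of the negation. Only marks with first component `q` count, which later lets a shared
branch be traced state by state. -/
theorem not_satByMarking_of_dual {q : A.State} {a : Alph} {M : S' → Set A.ComplState}
    (h : EUConstraint.SatByMarking M ((A.trans q a).dual (A.dualFormula q))) :
    ¬ (A.trans q a).SatByMarking fun t => {r | ∃ s ∈ M t, s.1.1 = q ∧ r ∈ s.1.2}ᶜ := by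
  classical
  refine PBF.not_sat_of_sat_dual (fun p hp hM => ?_) h
  rw [not_satByMarking_compl_iff p.enum p.enum_spec]
  rcases satByMarking_dualFormula_iff.1 hM with ⟨F, J, hc, -, hJ⟩ | ⟨F, J, hc, hJ, -⟩
  · refine .inl ⟨F, J, hc, fun t ht i hi => ?_⟩
    have hv := val_toComplState_image hp ⟨i, hi⟩
    refine ⟨_, hJ t ht, by rw [hv], ?_⟩
    rw [hv]
    exact Finset.mem_image_of_mem _ hi
  · refine .inr ⟨F, J, by rw [hc, Fintype.card_fin], fun t ht => ?_⟩
    have hv := val_toComplState_union hp F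
    refine ⟨fun u hu => ?_, fun i hi => ?_⟩ <;>
      refine ⟨_, hJ t ht, by rw [hv], ?_⟩ <;> rw [hv]
    · exact Finset.mem_union_left _ hu
    · exact Finset.mem_union_right _ (Finset.mem_image_of_mem _ hi)

theorem satByMarking_dual {q : A.State} {a : Alph} {N : S' → Set A.State}
    (h : ¬ (A.trans q a).SatByMarking fun t => (N t)ᶜ) :
    EUConstraint.SatByMarking (fun t => {s : A.ComplState | s.1.1 = q ∧ ∀ r ∈ s.1.2, r ∈ N t})
      ((A.trans q a).dual (A.dualFormula q)) := by
  classical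
  refine PBF.sat_dual_of_not_sat (fun p hp hM => ?_) h
  rw [not_satByMarking_compl_iff p.enum p.enum_spec, Fintype.card_fin] at hM
  refine satByMarking_dualFormula_iff.2 ?_
  have h0 : ∀ t, A.toComplState q ∅ ∈ {s : A.ComplState | s.1.1 = q ∧ ∀ r ∈ s.1.2, r ∈ N t} := by
    intro t
    change _ ∧ _
    rw [val_toComplState_empty]
    simp
  rcases hM with ⟨F, J, hc, hJ⟩ | ⟨F, J, hc, hJ⟩
  · refine .inl ⟨F, J, hc, fun t _ => h0 t, fun t ht => ?_⟩
    have hv := val_toComplState_image hp (Finset.card_pos.1 (Nat.zero_lt_of_lt hc))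
    change _ ∧ _
    rw [hv]
    refine ⟨rfl, fun r hr => ?_⟩
    obtain ⟨i, hi, rfl⟩ := Finset.mem_image.1 hr
    exact hJ t ht i hi
  · refine .inr ⟨F, J, hc, fun t ht => ?_, fun t _ => h0 t⟩
    change _ ∧ _
    rw [val_toComplState_union hp F]
    refine ⟨rfl, fun r hr => ?_⟩
    rcases Finset.mem_union.1 hr with hr | hr
    · exact (hJ t ht).1 r hr
    · obtain ⟨i, hi, rfl⟩ := Finset.mem_image.1 hr
      exact (hJ t ht).2 i hi

end Local

/-! ### The complement automaton recognises the complement -/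

section Language

variable {D : Type w} [Finite D] {T : LTree Alph D}

theorem accepts_or_compl_accepts (A : AAPTA.{u, v} Alph) (T : LTree Alph D) :
    A.Accepts T ∨ A.compl.Accepts T := by
  rcases (A.game T).determined (n := Finset.univ.sup A.prio + 1)
    (fun v => Nat.lt_succ_of_le (Finset.le_sup (f := A.prio) (Finset.mem_univ v.2)))
    (T.root, A.init) with ⟨R, σ, h0, h⟩ | ⟨R, σ, h0, h⟩
  · exact .inl (accepts_of_strategy h0 (fun v hv => h.mem v hv (Set.notMem_empty v))
      (fun v hv => h.subset v hv (Set.notMem_empty v))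
      fun p hR hp => h.parity p hR (fun i => Set.notMem_empty _) hp)
  · right
    -- A conjunction follows `σ` for each of its members; the first component of the next state
    -- names the member that was followed.
    let τ : T.nodes × A.compl.State → Set (T.nodes × A.compl.State) := fun v =>
      {w | w.2.1.1 ∈ v.2.1.2 ∧ ∀ r ∈ w.2.1.2, (w.1, r) ∈ σ (v.1, w.2.1.1)}
    refine accepts_of_strategy (σ := τ) (R := {v | ∀ q ∈ v.2.1.2, (v.1, q) ∈ R}) ?_ ?_ ?_ ?_
    · intro q hq
      have hv : A.compl.init.1 = _ := val_toComplState_init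
      rw [hv] at hq
      rw [Finset.mem_singleton.1 hq]
      exact h0
    · intro v hv
      refine PBF.sat_bigAnd.2 fun φ hφ => ?_
      obtain ⟨q, hq, rfl⟩ := List.mem_map.1 hφ
      rw [Finset.mem_toList] at hq
      have hs := satByMarking_dual (h.mem _ (hv q hq) (Set.notMem_empty _))
      refine EUConstraint.SatByMarking.mono ?_ hs
      rintro t s ⟨rfl, hr⟩
      exact ⟨hq, hr⟩
    · intro v hv w hw r hr
      exact h.subset _ (hv _ hw.1) (Set.notMem_empty _) (hw.2 r hr)
    · intro p hR hp
      refine parityAccepting_of_shift 1 ?_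
      -- The state followed at the node of `p i` is recorded only in `p (i + 1)`, hence the shift by
      -- one.
      refine h.parity (fun i => ((p i).1, (p (i + 1)).2.1.1)) (fun i => hR i _ (hp i).1)
        (fun i => Set.notMem_empty _) fun i => ?_
      exact (hp i).2 _ (hp (i + 1)).1

theorem not_compl_accepts_of_accepts (h : A.Accepts T) : ¬ A.compl.Accepts T := by
  obtain ⟨X, hX, hXb⟩ := h
  rintro ⟨Y, hY, hYb⟩
  let I := {x : X.nodes × Y.nodes //
    (X.label x.1).1 = (Y.label x.2).1 ∧ (X.label x.1).2 ∈ (Y.label x.2).2.1.2}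
  have hstep : ∀ x : I, ∃ y : I, y.1.1 ∈ X.succ x.1.1 ∧ y.1.2 ∈ Y.succ x.1.2 ∧
      (Y.label y.1.2).2.1.1 = (X.label x.1.1).2 := by
    rintro ⟨⟨n, n'⟩, hm, hq⟩
    change (X.label n).1 = (Y.label n').1 at hm
    change (X.label n).2 ∈ (Y.label n').2.1.2 at hq
    have h1 := hX.sat n
    have h2 := hY.sat n'
    rw [← hm] at h2
    have h3 := not_satByMarking_of_dual (PBF.sat_bigAnd.1 h2 _
      (List.mem_map.2 ⟨_, Finset.mem_toList.2 hq, rfl⟩))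
    -- If no successor carried a state both marked by `X` and refused by `Y`, monotonicity would
    -- satisfy a transition that `h3` says fails.
    have h4 : ∃ t, ¬ A.inducedMarking T X n (X.label n).1 t ⊆
        {r | ∃ s ∈ A.compl.inducedMarking T Y n' (X.label n).1 t,
          s.1.1 = (X.label n).2 ∧ r ∈ s.1.2}ᶜ := by
      by_contra! hc
      exact h3 (h1.mono hc)
    obtain ⟨t, ht⟩ := h4
    obtain ⟨r, ⟨d, hd, hr⟩, hr'⟩ := Set.not_subset.1 ht
    obtain ⟨s, ⟨d', hd', hs⟩, hsq, hrs⟩ := not_not.1 hr'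
    have hdd : d = d' := by
      rw [hd] at hd'
      simpa using hd'
    subst hdd
    have e1 := hX.label_snoc ⟨_, hr⟩ _ _ _ rfl
    have e2 := hY.label_snoc ⟨_, hs⟩ _ _ _ rfl
    refine ⟨⟨(⟨_, hr⟩, ⟨_, hs⟩), Subtype.ext ?_, ?_⟩, ⟨_, rfl⟩, ⟨_, rfl⟩, ?_⟩
    · rw [e1.1, e2.1, ← hX.label_fst, ← hY.label_fst, hm]
    · change (X.label ⟨_, hr⟩).2 ∈ (Y.label ⟨_, hs⟩).2.1.2
      rw [e1.2, e2.2]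
      exact hrs
    · change (Y.label ⟨_, hs⟩).2.1.1 = _
      rw [e2.2]
      exact hsq
  choose next hnX hnY hnq using hstep
  have h0 : (X.label X.root).1 = (Y.label Y.root).1 ∧
      (X.label X.root).2 ∈ (Y.label Y.root).2.1.2 := by
    rw [hX.label_root, hY.label_root]
    refine ⟨rfl, ?_⟩
    have hv : A.compl.init.1 = _ := val_toComplState_init
    rw [hv]
    exact Finset.mem_singleton_self _
  let b : ℕ → I := fun i => next^[i] ⟨(X.root, Y.root), h0⟩
  have hb : ∀ i, b (i + 1) = next (b i) := fun i => Function.iterate_succ_apply' _ _ _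
  have hbX : X.IsInfiniteBranch fun i => (b i).1.1 := ⟨rfl, fun i => by
    change (b (i + 1)).1.1 ∈ X.succ (b i).1.1
    rw [hb]
    exact hnX _⟩
  have hbY : Y.IsInfiniteBranch fun i => (b i).1.2 := ⟨rfl, fun i => by
    change (b (i + 1)).1.2 ∈ Y.succ (b i).1.2
    rw [hb]
    exact hnY _⟩
  have hy := (parityAccepting_shift_iff 1).2 (hYb _ hbY)
  refine not_parityAccepting_succ (hXb _ hbX) ?_
  convert hy using 2 with i
  change _ = A.prio (Y.label (b (i + 1)).1.2).2.1.1 + 1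
  rw [hb, hnq]

theorem language_compl (A : AAPTA.{u, v} Alph) (D : Type w) [Finite D] :
    A.compl.language D = (A.language D)ᶜ := by
  ext T
  exact ⟨fun h h' => not_compl_accepts_of_accepts h' h,
    fun h => (accepts_or_compl_accepts A T).resolve_left h⟩

end Language

end AAPTA

/-! ### Size bounds -/

namespace AAPTA

section Size

variable {Alph : Type u} {A : AAPTA.{u, v} Alph}

theorem card_pairStates_le (q : A.State) {p : EUPair A.State} {e : ℕ} (hp : p.E.card ≤ e)
    (he : 1 ≤ e) : (A.pairStates q p).card ≤ e * (1 + 2 ^ e) := by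
  classical
  have h1 : (A.pairStates q p).card ≤ (2 ^ p.E.card - 1) + 2 ^ p.E.card := by
    refine (Finset.card_union_le _ _).trans (Nat.add_le_add ?_ ?_) <;>
      refine Finset.card_image_le.trans_eq ?_
    · rw [Finset.card_erase_of_mem (Finset.mem_univ _)]
      simp
    · simp
  have h2 : 2 ^ p.E.card ≤ 2 ^ e := Nat.pow_le_pow_right two_pos hp
  have h3 : 1 ≤ 2 ^ p.E.card := Nat.one_le_two_pow
  rcases he.eq_or_lt with rfl | he
  · norm_num at h2 ⊢
    omega
  · have : 2 * (1 + 2 ^ e) ≤ e * (1 + 2 ^ e) := Nat.mul_le_mul_right _ he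
    omega

variable [Fintype Alph]

theorem size_trans_le (q : A.State) (a : Alph) : (A.trans q a).size ≤ A.sizeB :=
  Finset.le_sup (f := fun x : A.State × Alph => (A.trans x.1 x.2).size) (Finset.mem_univ (q, a))

theorem card_E_le {q : A.State} {a : Alph} {p : EUPair A.State} (hp : p ∈ (A.trans q a).vars) :
    p.E.card ≤ A.sizeE :=
  (PBF.le_maxVar (fun p : EUPair A.State => p.E.card) hp).trans
    (Finset.le_sup (f := fun x : A.State × Alph => (A.trans x.1 x.2).maxVar fun p => p.E.card)
      (Finset.mem_univ (q, a)))

theorem sizeQ_compl_le (A : AAPTA.{u, v} Alph) :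
    A.compl.sizeQ ≤ 1 + A.sizeQ * (2 + Fintype.card Alph * A.sizeB * max A.sizeE 1 *
      (1 + 2 ^ max A.sizeE 1)) := by
  classical
  set e := max A.sizeE 1
  have h0 : A.compl.sizeQ = A.complStates.card := Fintype.card_coe _
  have h1 : ∀ (q : A.State) (a : Alph),
      ((A.trans q a).vars.toFinset.biUnion (A.pairStates q)).card ≤
        A.sizeB * (e * (1 + 2 ^ e)) := by
    intro q a
    refine (Finset.card_biUnion_le_card_mul _ _ _ fun p hp =>
      card_pairStates_le q ((card_E_le (List.mem_toFinset.1 hp)).trans (le_max_left _ 1))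
        (le_max_right _ _)).trans (Nat.mul_le_mul_right _ ?_)
    exact (List.toFinset_card_le _).trans ((PBF.length_vars_le _).trans (size_trans_le q a))
  have h2 : A.complStates.card ≤
      A.sizeQ * (Fintype.card Alph * (A.sizeB * (e * (1 + 2 ^ e))) + 1) + 1 := by
    refine (Finset.card_insert_le _ _).trans (Nat.add_le_add_right ?_ 1)
    refine Finset.card_biUnion_le_card_mul _ _ _ fun q _ => ?_
    refine (Finset.card_insert_le _ _).trans (Nat.add_le_add_right ?_ 1)
    exact Finset.card_biUnion_le_card_mul _ _ _ fun a _ => h1 q a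
  rw [h0]
  refine h2.trans ?_
  rw [add_comm, ← mul_assoc, ← mul_assoc]
  exact Nat.add_le_add_left (Nat.mul_le_mul_left _ (by omega)) _

theorem card_dualPairs_le (q : A.State) (p : EUPair A.State) :
    (A.dualPairs q p).card ≤ 2 ^ p.E.card * p.E.card + 2 ^ p.E.card := by
  classical
  refine (Finset.card_union_le _ _).trans (Nat.add_le_add ?_ ?_) <;>
    refine Finset.card_image_le.trans ?_
  · refine (Finset.card_filter_le _ _).trans_eq ?_
    rw [Finset.card_product]
    simp
  · simp

theorem size_dualFormula_le {q : A.State} {p : EUPair A.State} {e : ℕ} (hp : p.E.card ≤ e) :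
    (A.dualFormula q p).size ≤ 2 ^ e * (e + 1) * 2 + 1 := by
  refine (PBF.size_bigOr_le (b := 1) ?_).trans ?_
  · intro φ hφ
    obtain ⟨x, -, rfl⟩ := List.mem_map.1 hφ
    exact le_rfl
  · rw [List.length_map, Finset.length_toList]
    refine Nat.add_le_add_right (Nat.mul_le_mul_right 2 ((card_dualPairs_le q p).trans ?_)) 1
    rw [← Nat.mul_succ]
    exact Nat.mul_le_mul (Nat.pow_le_pow_right two_pos hp) (Nat.succ_le_succ hp)

theorem sizeB_compl_le (A : AAPTA.{u, v} Alph) :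
    A.compl.sizeB ≤
      4 * (1 + A.sizeQ) * A.sizeB * max A.sizeE 1 ^ 3 * 4 ^ max A.sizeE 1 := by
  set e := max A.sizeE 1
  refine Finset.sup_le ?_
  rintro ⟨s, a⟩ -
  set b := 2 ^ e * (e + 1) * 2 + 1
  have h1 : (A.compl.trans s a).size ≤ A.sizeQ * (A.sizeB * b + 1) + 1 := by
    refine (PBF.size_bigAnd_le (b := A.sizeB * b) ?_).trans ?_
    · intro φ hφ
      obtain ⟨q, -, rfl⟩ := List.mem_map.1 hφ
      exact (PBF.size_dual_le (Nat.le_add_left _ _) fun p hp => size_dualFormula_le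
        ((card_E_le hp).trans (le_max_left _ 1))).trans (Nat.mul_le_mul_right _ (size_trans_le q a))
    · refine Nat.add_le_add_right (Nat.mul_le_mul_right _ ?_) 1
      exact ((List.length_map _).trans (Finset.length_toList _)).trans_le (Finset.card_le_univ _)
  -- Needed to absorb an additive 1 into the factor `A.sizeB` below.
  have hB : 1 ≤ A.sizeB :=
    le_trans (by cases A.trans A.init a <;> simp [PBF.size]) (size_trans_le A.init a)
  have he1 : 1 ≤ e := le_max_right _ _
  -- `b` comes from at most `2 ^ e * (e + 1)` disjuncts, each costing a variable and a connective,
  -- plus the final `bot`.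
  have h2 : b + 1 ≤ 4 * e ^ 3 * 4 ^ e := by
    have h4 : (4 : ℕ) ^ e = 2 ^ e * 2 ^ e := by rw [← mul_pow]; rfl
    have h5 : 2 ≤ 2 ^ e := Nat.le_self_pow (by omega) 2
    have h6 : e ≤ e ^ 3 := Nat.le_self_pow (by norm_num) e
    calc b + 1 = 2 ^ e * (e + 1) * 2 + 2 := rfl
      _ ≤ 2 ^ e * (2 * e) * 2 + 2 ^ e * (2 * e) * 2 := by
        refine Nat.add_le_add (Nat.mul_le_mul_right _ (Nat.mul_le_mul_left _ (by omega))) ?_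
        exact Nat.le_mul_of_pos_left 2 (by positivity)
      _ = 4 * e * (2 ^ e * 2) := by ring
      _ ≤ 4 * e ^ 3 * (2 ^ e * 2 ^ e) := by gcongr
      _ = 4 * e ^ 3 * 4 ^ e := by rw [h4]
  calc (A.compl.trans s a).size ≤ A.sizeQ * (A.sizeB * b + 1) + 1 := h1
    _ ≤ (1 + A.sizeQ) * (A.sizeB * b + 1) := by rw [Nat.add_mul]; omega
    _ ≤ (1 + A.sizeQ) * (A.sizeB * (b + 1)) :=
      Nat.mul_le_mul_left _ (Nat.add_le_add_left hB _)
    _ ≤ (1 + A.sizeQ) * (A.sizeB * (4 * e ^ 3 * 4 ^ e)) := by gcongr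
    _ = _ := by ring

theorem maxVar_compl_le (f : EUPair A.ComplState → ℕ) {b : ℕ}
    (h : ∀ q a, ∀ p ∈ (A.trans q a).vars, ∀ x ∈ A.dualPairs q p, f x ≤ b) :
    (Finset.univ.sup fun x : A.ComplState × Alph => (A.compl.trans x.1 x.2).maxVar f) ≤ b := by
  refine Finset.sup_le fun x _ => PBF.maxVar_bigAnd_le fun φ hφ => ?_
  obtain ⟨q, -, rfl⟩ := List.mem_map.1 hφ
  refine PBF.maxVar_dual_le fun p hp => PBF.maxVar_bigOr_le fun ψ hψ => ?_
  obtain ⟨y, hy, rfl⟩ := List.mem_map.1 hψ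
  exact h q _ p hp y (Finset.mem_toList.1 hy)

theorem card_le_of_mem_dualPairs {q : A.State} {p : EUPair A.State} {x : EUPair A.ComplState}
    (hx : x ∈ A.dualPairs q p) : x.E.card ≤ p.E.card + 1 ∧ x.U.card = 1 := by
  classical
  rcases Finset.mem_union.1 hx with hx | hx
  · obtain ⟨y, hy, rfl⟩ := Finset.mem_image.1 hx
    have := Finset.mem_range.1 (Finset.mem_product.1 (Finset.mem_filter.1 hy).1).2
    simp only [Multiset.card_replicate, Finset.card_singleton, and_true]
    omega
  · obtain ⟨F, -, rfl⟩ := Finset.mem_image.1 hx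
    simp only [Multiset.card_replicate, Finset.card_singleton, and_true]
    omega

theorem sizeE_compl_le (A : AAPTA.{u, v} Alph) : A.compl.sizeE ≤ A.sizeE + 1 :=
  maxVar_compl_le _ fun _ _ _ hp _ hx =>
    (card_le_of_mem_dualPairs hx).1.trans (Nat.add_le_add_right (card_E_le hp) 1)

theorem sizeU_compl_le (A : AAPTA.{u, v} Alph) : A.compl.sizeU ≤ 1 :=
  maxVar_compl_le _ fun _ _ _ _ _ hx => (card_le_of_mem_dualPairs hx).2.le

theorem sizeP_compl_le (A : AAPTA.{u, v} Alph) : A.compl.sizeP ≤ A.sizeP := by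
  classical
  refine le_trans (Finset.card_le_card ?_)
    (Finset.card_image_le (s := Finset.univ.image A.prio) (f := Nat.succ))
  intro k hk
  obtain ⟨s, -, rfl⟩ := Finset.mem_image.1 hk
  exact Finset.mem_image_of_mem _ (Finset.mem_image_of_mem _ (Finset.mem_univ s.1.1))

end Size

end AAPTA

end EUTree

theorem mainTheorem2 {Alph : Type u} [Fintype Alph] (A : EUTree.AAPTA.{u, v} Alph) :
    ∃ Ac : EUTree.AAPTA.{u, v} Alph,
      (∀ (D : Type w) [Finite D], Ac.language D = (A.language D)ᶜ) ∧
      Ac.SizeAtMost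
        (1 + A.sizeQ * (2 + Fintype.card Alph * A.sizeB * max A.sizeE 1 *
          (1 + 2 ^ max A.sizeE 1)))
        (4 * (1 + A.sizeQ) * A.sizeB * max A.sizeE 1 ^ 3 * 4 ^ max A.sizeE 1)
        (A.sizeE + 1)
        (max A.sizeU 1)
        (A.sizeP + 1) :=
  ⟨A.compl, fun D _ => A.language_compl D, A.sizeQ_compl_le, A.sizeB_compl_le, A.sizeE_compl_le,
    A.sizeU_compl_le.trans (le_max_right _ _), A.sizeP_compl_le.trans (Nat.le_succ _)⟩
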